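/- Let $d$ be a natural number, let $\gamma_d(dx)=\pi^{-d/2}e^{-|x|^2}\,dx$ be the Gaussian measure on $\mathbb{R}^d$, and for $t>0$ let $$T_tf(x)=\frac{1}{\pi^{d/2}(1-e^{-2t})^{d/2}}\int_{\mathbb{R}^d}e^{-\frac{|y-e^{-t}x|^2}{1-e^{-2t}}}f(y)\,dy$$ be the Ornstein--Uhlenbeck semigroup. For $x\in\mathbb{R}^d$ let $$\Gamma^p_\gamma(x)=\Big\{(y,t)\in\mathbb{R}^d\times(0,\infty):\ |y-x|<\min\big(t^{1/2},\tfrac{1}{|x|},1\big)\Big\}$$ be the parabolic Gaussian cone, with the convention $1/|x|=\infty$ for $x=0$. Then for every (real- or complex-valued) $f\in L^1(\gamma_d)$ the following hold. 1. $T_tf\in L^1(\gamma_d)$ for all $t>0$, and $T_tf\to f$ in $L^1(\gamma_d)$ as $t\to0^+$. 2. For almost every $x\in\mathbb{R}^d$, $\displaystyle\lim_{t\to0^+}T_tf(x)=f(x)$. 3. For almost every $x\in\mathbb{R}^d$, $T_tf(y)\to f(x)$ non-tangentially, that is, $\displaystyle\lim_{(y,t)\to(x,0),\ (y,t)\in\Gamma^p_\gamma(x)}T_tf(y)=f(x)$.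 -/

import Mathlib

open MeasureTheory Filter Topology

noncomputable section

/-- The Gaussian measure `γ_d(dx) = π^{-d/2} e^{-|x|²} dx` on `ℝ^d`. -/
def gaussianMeas (d : ℕ) : Measure (EuclideanSpace ℝ (Fin d)) :=
  volume.withDensity fun x =>
    ENNReal.ofReal (Real.exp (-‖x‖ ^ 2) / Real.pi ^ ((d : ℝ) / 2))

/-- The Ornstein-Uhlenbeck semigroup (for `t > 0`)
`T_t f(x) = π^{-d/2} (1 - e^{-2t})^{-d/2} ∫ exp(-|y - e^{-t} x|² / (1 - e^{-2t})) f(y) dy`. -/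
def ornsteinUhlenbeck {𝕜 : Type*} [RCLike 𝕜] {d : ℕ} (t : ℝ)
    (f : EuclideanSpace ℝ (Fin d) → 𝕜) (x : EuclideanSpace ℝ (Fin d)) : 𝕜 :=
  (1 / (Real.pi ^ ((d : ℝ) / 2) * (1 - Real.exp (-2 * t)) ^ ((d : ℝ) / 2))) •
    ∫ y, Real.exp (-‖y - Real.exp (-t) • x‖ ^ 2 / (1 - Real.exp (-2 * t))) • f y

/-- The parabolic Gaussian cone
`{(y, t) : t > 0, |y - x| < t^{1/2} ∧ 1/|x| ∧ 1}`, where `1/|x| = ∞` for `x = 0`. -/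
def parabolicGaussianCone {d : ℕ} (x : EuclideanSpace ℝ (Fin d)) :
    Set (EuclideanSpace ℝ (Fin d) × ℝ) :=
  {p | 0 < p.2 ∧ ‖p.1 - x‖ < Real.sqrt p.2 ∧ (x ≠ 0 → ‖p.1 - x‖ < 1 / ‖x‖) ∧ ‖p.1 - x‖ < 1}

end

/-!
The Mehler kernel is a Gaussian density of variance parameter `s = 1 - e^{-2t}` centred at
`e^{-t} x`, and it is reversible with respect to `γ`. Reversibility makes `γ` invariant, so that
`T_t` contracts `L¹(γ)`, and shows that away from `x` the kernel is small *relative to the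
density of `γ`*, which is what an `f` that is merely in `L¹(γ)` requires. Near `x`, inside a
parabolic cone, the centre `e^{-t} y` is within `O(√s)` of `x`, so the kernel is at most a constant
times the Gaussian density of parameter `2s` centred at `x`. The superlevel sets of that majorant
are balls around `x`, hence by the layer cake formula it turns smallness of the averages of
`‖f - f x‖` over balls into smallness of its integral, and `T_t f` converges non-tangentially at
every Lebesgue point of `f`. Convergence in `L¹(γ)` follows by dominated convergence for bounded
functions, and by density and contractivity in general.
-/

noncomputable section

open Metric Module Real Set
open scoped ENNReal NNReal

theorem tendsto_nhds_zero_of_eventually_le_mul {ι : Type*} {l : Filter ι} {u : ι → ℝ≥0∞}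
    {M : ℝ≥0∞} (hM : M ≠ ∞) (h : ∀ η : ℝ≥0, 0 < η → ∀ᶠ i in l, u i ≤ η * M) :
    Tendsto u l (𝓝 0) := by
  refine ENNReal.tendsto_nhds_zero.2 fun ε hε => ?_
  obtain ⟨η, hη, hηM⟩ := ENNReal.exists_nnreal_pos_mul_lt hM hε.ne'
  exact (h η hη).mono fun i hi => hi.trans hηM.le

section MeasureSpace

variable {α : Type*} [MeasurableSpace α] {μ : Measure α}

theorem lintegral_ofReal_le_mul_of_measure_lt_le {ν : Measure α} {φ : α → ℝ}
    (hφ : Measurable φ) (hφ₀ : ∀ z, 0 ≤ φ z) {c : ℝ≥0∞}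
    (h : ∀ r, 0 < r → ν {z | r < φ z} ≤ c * μ {z | r < φ z}) :
    ∫⁻ z, ENNReal.ofReal (φ z) ∂ν ≤ c * ∫⁻ z, ENNReal.ofReal (φ z) ∂μ := by
  have hanti : Antitone fun r => μ {z | r < φ z} :=
    fun _ _ hrs => measure_mono fun _ hz => lt_of_le_of_lt hrs hz
  rw [lintegral_eq_lintegral_meas_lt ν (ae_of_all _ hφ₀) hφ.aemeasurable,
    lintegral_eq_lintegral_meas_lt μ (ae_of_all _ hφ₀) hφ.aemeasurable,
    ← lintegral_const_mul c hanti.measurable]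
  exact setLIntegral_mono (hanti.measurable.const_mul c) h

variable {E : Type*} [NormedAddCommGroup E] [NormedSpace ℝ E] {k : α → ℝ}

theorem enorm_integral_smul_le (hk : ∀ z, 0 ≤ k z) (f : α → E) :
    ‖∫ z, k z • f z ∂μ‖ₑ ≤ ∫⁻ z, ENNReal.ofReal (k z) * ‖f z‖ₑ ∂μ := by
  refine (enorm_integral_le_lintegral_enorm _).trans_eq (lintegral_congr fun z => ?_)
  rw [enorm_smul, Real.enorm_eq_ofReal (hk z)]

theorem enorm_integral_smul_sub_le [CompleteSpace E] {f : α → E} (hk : ∀ z, 0 ≤ k z)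
    (hk₁ : ∫ z, k z ∂μ = 1) (hkf : Integrable (fun z => k z • f z) μ) (c : E) :
    ‖(∫ z, k z • f z ∂μ) - c‖ₑ ≤ ∫⁻ z, ENNReal.ofReal (k z) * ‖f z - c‖ₑ ∂μ := by
  have hsub : (∫ z, k z • f z ∂μ) - c = ∫ z, k z • (f z - c) ∂μ := by
    simp_rw [smul_sub]
    rw [integral_sub hkf ((integrable_of_integral_eq_one hk₁).smul_const c), integral_smul_const,
      hk₁, one_smul]
  rw [hsub]
  exact enorm_integral_smul_le hk _

end MeasureSpace

section GaussianKernel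

variable {V : Type*} [NormedAddCommGroup V] [InnerProductSpace ℝ V]

/-- The Gaussian density `(π s)^{-n/2} e^{-|v|²/s}` on an `n`-dimensional inner product space.
The powers of `π` and `s` are kept apart to match `ornsteinUhlenbeck` for every real `t`. -/
def gaussianKernel (s : ℝ) (v : V) : ℝ :=
  1 / (π ^ ((finrank ℝ V : ℝ) / 2) * s ^ ((finrank ℝ V : ℝ) / 2)) * exp (-‖v‖ ^ 2 / s)

variable {s : ℝ}

theorem gaussianKernel_pos (hs : 0 < s) (v : V) : 0 < gaussianKernel s v := by
  unfold gaussianKernel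
  positivity

@[fun_prop]
theorem continuous_gaussianKernel (s : ℝ) : Continuous (gaussianKernel s : V → ℝ) := by
  unfold gaussianKernel
  fun_prop

theorem gaussianKernel_eq_mul_exp (s : ℝ) (v : V) :
    gaussianKernel s v = gaussianKernel s (0 : V) * exp (-‖v‖ ^ 2 / s) := by
  simp [gaussianKernel]

theorem gaussianKernel_le_of_norm_le (hs : 0 < s) {u v : V} (huv : ‖u‖ ≤ ‖v‖) :
    gaussianKernel s v ≤ gaussianKernel s u := by
  unfold gaussianKernel
  gcongr

theorem gaussianKernel_le_mul_gaussianKernel_two_mul (hs : 0 < s) (u v : V) :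
    gaussianKernel s u ≤ 2 ^ ((finrank ℝ V : ℝ) / 2) * exp (‖v‖ ^ 2 / s) *
      gaussianKernel (2 * s) (u + v) := by
  have hsq : ‖u + v‖ ^ 2 ≤ 2 * (‖u‖ ^ 2 + ‖v‖ ^ 2) :=
    (pow_le_pow_left₀ (norm_nonneg _) (norm_add_le u v) 2).trans add_sq_le
  have hexp : -‖u‖ ^ 2 / s ≤ ‖v‖ ^ 2 / s + -‖u + v‖ ^ 2 / (2 * s) := by
    rw [div_add_div _ _ hs.ne' (by positivity), div_le_div_iff₀ hs (by positivity)]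
    nlinarith [mul_le_mul_of_nonneg_left hsq (sq_nonneg s)]
  calc gaussianKernel s u
      ≤ 1 / (π ^ ((finrank ℝ V : ℝ) / 2) * s ^ ((finrank ℝ V : ℝ) / 2)) *
          exp (‖v‖ ^ 2 / s + -‖u + v‖ ^ 2 / (2 * s)) := by
        unfold gaussianKernel
        gcongr
    _ = _ := by
        rw [gaussianKernel, mul_rpow zero_le_two hs.le, exp_add]
        field_simp

theorem exists_setOf_lt_gaussianKernel_eq_ball (hs : 0 < s) (x : V) {r : ℝ} (hr : 0 < r) :
    ∃ ρ, {z | r < gaussianKernel s (z - x)} = ball x ρ := by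
  have hk : 0 < gaussianKernel s (0 : V) := gaussianKernel_pos hs 0
  refine ⟨√(-s * log (r / gaussianKernel s (0 : V))), ext fun z => ?_⟩
  rw [mem_ofPred_eq, mem_ball_iff_norm, lt_sqrt (norm_nonneg _), gaussianKernel_eq_mul_exp,
    ← div_lt_iff₀' hk, ← log_lt_iff_lt_exp (div_pos hr hk), lt_div_iff₀ hs]
  constructor <;> intro h <;> linarith

theorem eventually_gaussianKernel_le {δ ε : ℝ} (hδ : 0 < δ) (hε : 0 < ε) :
    ∀ᶠ s in 𝓝[>] (0 : ℝ), ∀ v : V, δ ≤ ‖v‖ → gaussianKernel s v ≤ ε := by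
  set n := (finrank ℝ V : ℝ) / 2
  have hlim : Tendsto (fun s : ℝ => 1 / π ^ n * (s⁻¹ ^ n * exp (-δ ^ 2 * s⁻¹)))
      (𝓝[>] 0) (𝓝 0) := by
    simpa using ((tendsto_rpow_mul_exp_neg_mul_atTop_nhds_zero n (δ ^ 2) (by positivity)).comp
      tendsto_inv_nhdsGT_zero).const_mul (1 / π ^ n)
  filter_upwards [self_mem_nhdsWithin, hlim.eventually_le_const hε] with s (hs : 0 < s) hsε v hv
  calc gaussianKernel s v
      ≤ 1 / (π ^ n * s ^ n) * exp (-δ ^ 2 / s) := by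
        unfold gaussianKernel
        gcongr
    _ = 1 / π ^ n * (s⁻¹ ^ n * exp (-δ ^ 2 * s⁻¹)) := by
        rw [inv_rpow hs.le]
        field_simp
    _ ≤ ε := hsε

variable [MeasurableSpace V] [BorelSpace V]

theorem measurable_ofReal_gaussianKernel (s : ℝ) :
    Measurable fun x : V => ENNReal.ofReal (gaussianKernel s x) :=
  (continuous_gaussianKernel s).measurable.ennreal_ofReal

variable [FiniteDimensional ℝ V]

theorem integral_gaussianKernel (hs : 0 < s) : ∫ v : V, gaussianKernel s v = 1 := by
  have hexp : ∀ v : V, exp (-‖v‖ ^ 2 / s) = exp (-s⁻¹ * ‖v‖ ^ 2) := fun v => by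
    congr 1
    ring
  simp_rw [gaussianKernel, hexp]
  rw [integral_const_mul, GaussianFourier.integral_rexp_neg_mul_sq_norm (inv_pos.2 hs),
    div_inv_eq_mul, mul_rpow pi_pos.le hs.le, one_div_mul_cancel (by positivity)]

theorem lintegral_gaussianKernel (hs : 0 < s) :
    ∫⁻ v : V, ENNReal.ofReal (gaussianKernel s v) = 1 := by
  rw [← ofReal_integral_eq_lintegral_ofReal
    (integrable_of_integral_eq_one (integral_gaussianKernel hs))
    (ae_of_all _ fun v => (gaussianKernel_pos hs v).le), integral_gaussianKernel hs,
    ENNReal.ofReal_one]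

theorem lintegral_gaussianKernel_mul_le (hs : 0 < s) {g : V → ℝ≥0∞} (hg : AEMeasurable g) (x : V)
    {c : ℝ≥0∞} (hc : ∀ r, ∫⁻ z in ball x r, g z ≤ c * volume (ball x r)) :
    ∫⁻ z, ENNReal.ofReal (gaussianKernel s (z - x)) * g z ≤ c := by
  have hφ : Measurable fun z => gaussianKernel s (z - x) := by fun_prop
  calc ∫⁻ z, ENNReal.ofReal (gaussianKernel s (z - x)) * g z
      = ∫⁻ z, ENNReal.ofReal (gaussianKernel s (z - x)) ∂(volume.withDensity g) := by
        rw [lintegral_withDensity_eq_lintegral_mul₀ hg hφ.ennreal_ofReal.aemeasurable]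
        simp_rw [Pi.mul_apply, mul_comm]
    _ ≤ c * ∫⁻ z, ENNReal.ofReal (gaussianKernel s (z - x)) := by
        refine lintegral_ofReal_le_mul_of_measure_lt_le hφ
          (fun z => (gaussianKernel_pos hs _).le) fun r hr => ?_
        obtain ⟨ρ, hρ⟩ := exists_setOf_lt_gaussianKernel_eq_ball hs x hr
        rw [hρ, withDensity_apply _ measurableSet_ball]
        exact hc ρ
    _ = c := by
        rw [lintegral_sub_right_eq_self fun v : V => ENNReal.ofReal (gaussianKernel s v),
          lintegral_gaussianKernel hs, mul_one]

end GaussianKernel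

section LebesguePoint

variable {V : Type*} [NormedAddCommGroup V] [InnerProductSpace ℝ V] [FiniteDimensional ℝ V]
  [MeasurableSpace V] [BorelSpace V]
variable {E : Type*} [NormedAddCommGroup E] {f : V → E} {x : V}

/-- `x` is a Lebesgue point of `f`: the averages of `‖f - f x‖` over the closed balls of
radius `r` centred at `x` tend to zero as `r → 0⁺`. -/
def IsLebesguePoint (f : V → E) (x : V) : Prop :=
  Tendsto (fun r => (∫⁻ z in closedBall x r, ‖f z - f x‖ₑ) / volume (closedBall x r))
    (𝓝[>] 0) (𝓝 0)

theorem ae_isLebesguePoint (hf : LocallyIntegrable f) : ∀ᵐ x, IsLebesguePoint f x :=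
  ((Besicovitch.vitaliFamily volume).ae_tendsto_lintegral_enorm_sub_div hf).mono fun x hx =>
    hx.comp (Besicovitch.tendsto_filterAt volume x)

theorem IsLebesguePoint.exists_setLIntegral_indicator_le (hx : IsLebesguePoint f x) {η : ℝ≥0∞}
    (hη : 0 < η) :
    ∃ δ > 0, ∀ r, ∫⁻ z in ball x r, (closedBall x δ).indicator (fun z => ‖f z - f x‖ₑ) z ≤
      η * volume (ball x r) := by
  obtain ⟨δ, hδ, hδη⟩ :=
    mem_nhdsGT_iff_exists_Ioc_subset.1 (Filter.Tendsto.eventually_lt_const hη hx)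
  refine ⟨δ, hδ, fun r => ?_⟩
  rcases le_or_gt r 0 with hr | hr
  · simp [ball_eq_empty.2 hr]
  have hm : 0 < min δ r := lt_min hδ hr
  have hsub : closedBall x δ ∩ ball x r ⊆ closedBall x (min δ r) :=
    fun z hz => mem_closedBall.2 (le_min hz.1 (mem_ball.1 hz.2).le)
  rw [setLIntegral_indicator measurableSet_closedBall]
  calc ∫⁻ z in closedBall x δ ∩ ball x r, ‖f z - f x‖ₑ
      ≤ ∫⁻ z in closedBall x (min δ r), ‖f z - f x‖ₑ := lintegral_mono_set hsub
    _ ≤ η * volume (closedBall x (min δ r)) :=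
        (ENNReal.div_le_iff (measure_closedBall_pos _ _ hm).ne' measure_closedBall_lt_top.ne).1
          (hδη ⟨hm, min_le_left δ r⟩).le
    _ ≤ η * volume (closedBall x r) := by
        gcongr
        exact min_le_right δ r
    _ = η * volume (ball x r) := by
        rw [Measure.addHaar_closedBall _ _ hr.le, Measure.addHaar_ball_of_pos _ _ hr]

variable {k : V → ℝ} {C δ s : ℝ} {η : ℝ≥0}

theorem setLIntegral_closedBall_le_of_le_gaussianKernel (hf : AEStronglyMeasurable f)
    (hs : 0 < s) (hC : 0 ≤ C) (hk : ∀ z, k z ≤ C * gaussianKernel s (z - x))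
    (hη : ∀ r, ∫⁻ z in ball x r, (closedBall x δ).indicator (fun z => ‖f z - f x‖ₑ) z ≤
      η * volume (ball x r)) :
    ∫⁻ z in closedBall x δ, ENNReal.ofReal (k z) * ‖f z - f x‖ₑ ≤ η * ENNReal.ofReal C := by
  have hmeas : AEMeasurable ((closedBall x δ).indicator fun z => ‖f z - f x‖ₑ) :=
    (hf.sub aestronglyMeasurable_const).enorm.indicator measurableSet_closedBall
  calc ∫⁻ z in closedBall x δ, ENNReal.ofReal (k z) * ‖f z - f x‖ₑ
      ≤ ∫⁻ z in closedBall x δ, ENNReal.ofReal C *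
          (ENNReal.ofReal (gaussianKernel s (z - x)) * ‖f z - f x‖ₑ) := by
        refine lintegral_mono fun z => ?_
        rw [← mul_assoc, ← ENNReal.ofReal_mul hC]
        gcongr
        exact hk z
    _ = ENNReal.ofReal C * ∫⁻ z, ENNReal.ofReal (gaussianKernel s (z - x)) *
          (closedBall x δ).indicator (fun z => ‖f z - f x‖ₑ) z := by
        rw [lintegral_const_mul' _ _ ENNReal.ofReal_ne_top,
          ← lintegral_indicator measurableSet_closedBall]
        simp_rw [indicator_mul_right]
    _ ≤ ENNReal.ofReal C * η := by
        gcongr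
        exact lintegral_gaussianKernel_mul_le hs hmeas x hη
    _ = η * ENNReal.ofReal C := mul_comm _ _

theorem setLIntegral_compl_closedBall_le_of_le_mul {w : V → ℝ}
    (hk : ∀ z, δ < ‖z - x‖ → k z ≤ η * w z) :
    ∫⁻ z in (closedBall x δ)ᶜ, ENNReal.ofReal (k z) * ‖f z - f x‖ₑ ≤
      η * ∫⁻ z, ENNReal.ofReal (w z) * ‖f z - f x‖ₑ := by
  calc ∫⁻ z in (closedBall x δ)ᶜ, ENNReal.ofReal (k z) * ‖f z - f x‖ₑ
      ≤ ∫⁻ z in (closedBall x δ)ᶜ, η * (ENNReal.ofReal (w z) * ‖f z - f x‖ₑ) := by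
        refine setLIntegral_mono' measurableSet_closedBall.compl fun z hz => ?_
        rw [← mul_assoc, ← ENNReal.ofReal_coe_nnreal, ← ENNReal.ofReal_mul η.coe_nonneg]
        gcongr
        exact hk z (by simpa [dist_eq_norm] using hz)
    _ ≤ ∫⁻ z, η * (ENNReal.ofReal (w z) * ‖f z - f x‖ₑ) := setLIntegral_le_lintegral _ _
    _ = η * ∫⁻ z, ENNReal.ofReal (w z) * ‖f z - f x‖ₑ :=
        lintegral_const_mul' _ _ ENNReal.coe_ne_top

variable [NormedSpace ℝ E]

theorem IsLebesguePoint.tendsto_integral_smul [CompleteSpace E] (hx : IsLebesguePoint f x)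
    (hf : AEStronglyMeasurable f) {ι : Type*} {l : Filter ι} {k : ι → V → ℝ} {s : ι → ℝ}
    {w : V → ℝ} (hC : 0 ≤ C) (hwf : ∫⁻ z, ENNReal.ofReal (w z) * ‖f z - f x‖ₑ ≠ ∞)
    (hs : ∀ᶠ i in l, 0 < s i) (hk : ∀ᶠ i in l, ∀ z, 0 ≤ k i z)
    (hk₁ : ∀ᶠ i in l, ∫ z, k i z = 1) (hkf : ∀ᶠ i in l, Integrable fun z => k i z • f z)
    (hnear : ∀ᶠ i in l, ∀ z, k i z ≤ C * gaussianKernel (s i) (z - x))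
    (hfar : ∀ δ > 0, ∀ η > 0, ∀ᶠ i in l, ∀ z, δ < ‖z - x‖ → k i z ≤ η * w z) :
    Tendsto (fun i => ∫ z, k i z • f z) l (𝓝 (f x)) := by
  rw [← tendsto_sub_nhds_zero_iff, tendsto_zero_iff_enorm_tendsto_zero]
  refine tendsto_nhds_zero_of_eventually_le_mul
    (ENNReal.add_ne_top.2 ⟨ENNReal.ofReal_ne_top (r := C), hwf⟩) fun η hη => ?_
  obtain ⟨δ, hδ, hball⟩ := hx.exists_setLIntegral_indicator_le (ENNReal.coe_pos.2 hη)
  filter_upwards [hs, hk, hk₁, hkf, hnear, hfar δ hδ η hη] with i hs hk hk₁ hkf hnear hfar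
  refine (enorm_integral_smul_sub_le hk hk₁ hkf (f x)).trans ?_
  rw [← lintegral_add_compl _ (measurableSet_closedBall (x := x) (ε := δ)), mul_add]
  exact add_le_add (setLIntegral_closedBall_le_of_le_gaussianKernel hf hs hC hnear hball)
    (setLIntegral_compl_closedBall_le_of_le_mul hfar)

end LebesguePoint

section Mehler

variable {V : Type*} [NormedAddCommGroup V] [InnerProductSpace ℝ V]

/-- The Mehler kernel: the density at `z`, with respect to Lebesgue measure, of the
Ornstein-Uhlenbeck process at time `t` started at `x`. -/
def mehlerKernel (t : ℝ) (x z : V) : ℝ :=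
  gaussianKernel (1 - exp (-2 * t)) (z - exp (-t) • x)

variable {t : ℝ}

theorem one_sub_exp_neg_two_mul_pos (ht : 0 < t) : 0 < 1 - exp (-2 * t) :=
  sub_pos.2 (exp_lt_one_iff.2 (by linarith))

theorem tendsto_one_sub_exp_neg_two_mul :
    Tendsto (fun t : ℝ => 1 - exp (-2 * t)) (𝓝[>] 0) (𝓝[>] 0) := by
  refine tendsto_nhdsWithin_iff.2 ⟨?_, ?_⟩
  · have hcont : Continuous fun t : ℝ => 1 - exp (-2 * t) := by fun_prop
    simpa using (hcont.tendsto 0).mono_left nhdsWithin_le_nhds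
  · filter_upwards [self_mem_nhdsWithin] with t ht using one_sub_exp_neg_two_mul_pos ht

theorem le_one_sub_exp_neg_two_mul (ht₀ : 0 ≤ t) (ht : t ≤ 1 / 2) : t ≤ 1 - exp (-2 * t) := by
  have hexp : 2 * t + 1 ≤ exp (2 * t) := add_one_le_exp _
  have hmul : exp (-2 * t) * exp (2 * t) = 1 := by rw [← exp_add]; simp
  nlinarith [exp_pos (-2 * t)]

theorem mehlerKernel_pos (ht : 0 < t) (x z : V) : 0 < mehlerKernel t x z :=
  gaussianKernel_pos (one_sub_exp_neg_two_mul_pos ht) _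

theorem continuous_mehlerKernel (t : ℝ) :
    Continuous fun p : V × V => mehlerKernel t p.1 p.2 := by
  unfold mehlerKernel
  fun_prop

theorem gaussianKernel_mul_mehlerKernel_comm (ht : 0 < t) (x z : V) :
    gaussianKernel 1 x * mehlerKernel t x z = gaussianKernel 1 z * mehlerKernel t z x := by
  have hs := one_sub_exp_neg_two_mul_pos ht
  have hexponent : -‖x‖ ^ 2 / 1 + -‖z - exp (-t) • x‖ ^ 2 / (1 - exp (-2 * t)) =
      -‖z‖ ^ 2 / 1 + -‖x - exp (-t) • z‖ ^ 2 / (1 - exp (-2 * t)) := by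
    have hsq : exp (-t) ^ 2 = exp (-2 * t) := by rw [← exp_nat_mul]; congr 1; push_cast; ring
    rw [norm_sub_sq_real, norm_sub_sq_real, norm_smul, norm_smul, inner_smul_right,
      inner_smul_right, real_inner_comm, mul_pow, mul_pow, norm_eq_abs, sq_abs, hsq]
    generalize exp (-2 * t) = u at *
    field_simp
    ring
  simp only [mehlerKernel, gaussianKernel, mul_mul_mul_comm _ (exp _), ← exp_add, hexponent]

theorem mehlerKernel_le_mul_gaussianKernel_one_of_swap (ht : 0 < t) {y z : V} {r : ℝ}
    (h : mehlerKernel t z y ≤ r * gaussianKernel 1 y) :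
    mehlerKernel t y z ≤ r * gaussianKernel 1 z := by
  refine le_of_mul_le_mul_left ?_ (gaussianKernel_pos one_pos y)
  rw [gaussianKernel_mul_mehlerKernel_comm ht]
  nlinarith [gaussianKernel_pos one_pos z]

theorem norm_exp_neg_smul_sub_sq_div_le {x y : V} {a : ℝ} (ht₀ : 0 < t) (ht : t ≤ 1 / 2)
    (hy : ‖y - x‖ ≤ a * √t) :
    ‖exp (-t) • y - x‖ ^ 2 / (1 - exp (-2 * t)) ≤ (‖x‖ + a) ^ 2 := by
  have hexp : exp (-t) ≤ 1 := exp_le_one_iff.2 (by linarith)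
  have htsqrt : 1 - exp (-t) ≤ √t :=
    (by linarith [add_one_le_exp (-t)] : 1 - exp (-t) ≤ t).trans
      (le_sqrt_of_sq_le (by nlinarith))
  have hnorm : ‖exp (-t) • y - x‖ ≤ √t * (‖x‖ + a) :=
    calc ‖exp (-t) • y - x‖ = ‖exp (-t) • (y - x) - (1 - exp (-t)) • x‖ := by
          congr 1
          module
      _ ≤ exp (-t) * ‖y - x‖ + (1 - exp (-t)) * ‖x‖ := by
          refine (norm_sub_le _ _).trans_eq ?_
          rw [norm_smul, norm_smul, norm_of_nonneg (exp_pos _).le, norm_of_nonneg (by linarith)]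
      _ ≤ 1 * (a * √t) + √t * ‖x‖ := by gcongr
      _ = √t * (‖x‖ + a) := by ring
  rw [div_le_iff₀ (one_sub_exp_neg_two_mul_pos ht₀)]
  calc ‖exp (-t) • y - x‖ ^ 2 ≤ (√t * (‖x‖ + a)) ^ 2 := by gcongr
    _ = (‖x‖ + a) ^ 2 * t := by rw [mul_pow, sq_sqrt ht₀.le, mul_comm]
    _ ≤ (‖x‖ + a) ^ 2 * (1 - exp (-2 * t)) := by
        gcongr
        exact le_one_sub_exp_neg_two_mul ht₀.le ht

theorem mehlerKernel_le_mul_gaussianKernel_sub {x y : V} {a : ℝ} (ht₀ : 0 < t) (ht : t ≤ 1 / 2)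
    (hy : ‖y - x‖ ≤ a * √t) (z : V) :
    mehlerKernel t y z ≤ 2 ^ ((finrank ℝ V : ℝ) / 2) * exp ((‖x‖ + a) ^ 2) *
      gaussianKernel (2 * (1 - exp (-2 * t))) (z - x) := by
  have hs := one_sub_exp_neg_two_mul_pos ht₀
  have hpos := gaussianKernel_pos (mul_pos two_pos hs) (z - x)
  have h := gaussianKernel_le_mul_gaussianKernel_two_mul hs (z - exp (-t) • y) (exp (-t) • y - x)
  rw [sub_add_sub_cancel] at h
  refine h.trans ?_
  gcongr
  exact norm_exp_neg_smul_sub_sq_div_le ht₀ ht hy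

theorem eventually_mehlerKernel_le_mul_gaussianKernel_one (x : V) {δ η : ℝ} (hδ : 0 < δ)
    (hη : 0 < η) :
    ∀ᶠ p : V × ℝ in 𝓝 x ×ˢ 𝓝[>] 0, ∀ z, δ < ‖z - x‖ →
      mehlerKernel p.2 p.1 z ≤ η * gaussianKernel 1 z := by
  have hγ : 0 < gaussianKernel 1 x := gaussianKernel_pos one_pos x
  have hle : 𝓝 x ×ˢ 𝓝[>] (0 : ℝ) ≤ 𝓝 (x, 0) := by
    rw [nhds_prod_eq]
    exact prod_mono le_rfl nhdsWithin_le_nhds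
  have hcentre : ∀ᶠ p : V × ℝ in 𝓝 x ×ˢ 𝓝[>] 0,
      δ / 2 < exp (-p.2) * δ - ‖p.1 - exp (-p.2) • x‖ := by
    have hcont : Continuous fun p : V × ℝ => exp (-p.2) * δ - ‖p.1 - exp (-p.2) • x‖ := by
      fun_prop
    exact hle (hcont.continuousAt.eventually_const_lt (by simpa using half_lt_self hδ))
  have hdensity : ∀ᶠ p : V × ℝ in 𝓝 x ×ˢ 𝓝[>] 0,
      gaussianKernel 1 x / 2 < gaussianKernel 1 p.1 :=
    tendsto_fst.eventually
      ((continuous_gaussianKernel 1).continuousAt.eventually_const_lt (half_lt_self hγ))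
  have hsmall : ∀ᶠ p : V × ℝ in 𝓝 x ×ˢ 𝓝[>] 0, ∀ v : V, δ / 2 ≤ ‖v‖ →
      gaussianKernel (1 - exp (-2 * p.2)) v ≤ η * (gaussianKernel 1 x / 2) :=
    (tendsto_one_sub_exp_neg_two_mul.comp tendsto_snd).eventually
      (eventually_gaussianKernel_le (half_pos hδ) (by positivity))
  have hpos : ∀ᶠ p : V × ℝ in 𝓝 x ×ˢ 𝓝[>] 0, 0 < p.2 :=
    tendsto_snd.eventually self_mem_nhdsWithin
  filter_upwards [hcentre, hdensity, hsmall, hpos] with ⟨y, t⟩ hcentre hdensity hsmall ht z hz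
  have hdist : δ / 2 ≤ ‖y - exp (-t) • z‖ := by
    have htri := norm_sub_le (y - exp (-t) • x) (y - exp (-t) • z)
    rw [sub_sub_sub_cancel_left, ← smul_sub, norm_smul, norm_of_nonneg (exp_pos _).le] at htri
    nlinarith [exp_pos (-t)]
  refine mehlerKernel_le_mul_gaussianKernel_one_of_swap ht ((hsmall _ hdist).trans ?_)
  gcongr

variable [FiniteDimensional ℝ V] [MeasurableSpace V] [BorelSpace V]

theorem integral_mehlerKernel (ht : 0 < t) (x : V) : ∫ z, mehlerKernel t x z = 1 := by
  simp only [mehlerKernel]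
  rw [integral_sub_right_eq_self (gaussianKernel (1 - exp (-2 * t))),
    integral_gaussianKernel (one_sub_exp_neg_two_mul_pos ht)]

theorem lintegral_mehlerKernel_mul_const (ht : 0 < t) (x : V) (c : ℝ≥0∞) :
    ∫⁻ z, ENNReal.ofReal (mehlerKernel t x z) * c = c := by
  simp only [mehlerKernel]
  rw [lintegral_sub_right_eq_self fun v : V =>
    ENNReal.ofReal (gaussianKernel (1 - exp (-2 * t)) v) * c,
    lintegral_mul_const _ (measurable_ofReal_gaussianKernel _),
    lintegral_gaussianKernel (one_sub_exp_neg_two_mul_pos ht), one_mul]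

end Mehler

section GaussianMeasure

variable {V : Type*} [NormedAddCommGroup V] [InnerProductSpace ℝ V] [FiniteDimensional ℝ V]
  [MeasurableSpace V] [BorelSpace V]
variable {E : Type*} [NormedAddCommGroup E] {f : V → E}

variable (V) in
/-- The Gaussian measure `γ(dx) = π^{-n/2} e^{-|x|²} dx` on an `n`-dimensional inner product
space; it is `gaussianMeas d` for `EuclideanSpace ℝ (Fin d)`. -/
def gaussianMeasure : Measure V :=
  volume.withDensity fun x => ENNReal.ofReal (gaussianKernel 1 x)

theorem lintegral_gaussianMeasure (g : V → ℝ≥0∞) :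
    ∫⁻ x, g x ∂(gaussianMeasure V) = ∫⁻ x, ENNReal.ofReal (gaussianKernel 1 x) * g x :=
  lintegral_withDensity_eq_lintegral_mul_non_measurable _ (measurable_ofReal_gaussianKernel 1)
    (ae_of_all _ fun _ => ENNReal.ofReal_lt_top) g

instance isProbabilityMeasure_gaussianMeasure : IsProbabilityMeasure (gaussianMeasure V) where
  measure_univ := by
    rw [gaussianMeasure, withDensity_apply _ MeasurableSet.univ, Measure.restrict_univ,
      lintegral_gaussianKernel one_pos]

theorem gaussianMeasure_absolutelyContinuous : gaussianMeasure V ≪ volume :=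
  withDensity_absolutelyContinuous _ _

theorem volume_absolutelyContinuous_gaussianMeasure :
    (volume : Measure V) ≪ gaussianMeasure V :=
  withDensity_absolutelyContinuous' (measurable_ofReal_gaussianKernel 1).aemeasurable
    (ae_of_all _ fun x => (ENNReal.ofReal_pos.2 (gaussianKernel_pos one_pos x)).ne')

theorem aestronglyMeasurable_of_gaussianMeasure (hf : AEStronglyMeasurable f (gaussianMeasure V)) :
    AEStronglyMeasurable f :=
  hf.mono_ac volume_absolutelyContinuous_gaussianMeasure

variable [NormedSpace ℝ E]

theorem integrable_gaussianMeasure_iff :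
    Integrable f (gaussianMeasure V) ↔ Integrable fun x => gaussianKernel 1 x • f x := by
  rw [gaussianMeasure, integrable_withDensity_iff_integrable_smul'
    (measurable_ofReal_gaussianKernel 1) (ae_of_all _ fun x => ENNReal.ofReal_lt_top)]
  simp_rw [ENNReal.toReal_ofReal (gaussianKernel_pos one_pos _).le]

theorem locallyIntegrable_of_integrable_gaussianMeasure (hf : Integrable f (gaussianMeasure V)) :
    LocallyIntegrable f := by
  have hinv := (integrable_gaussianMeasure_iff.1 hf).locallyIntegrable.continuous_smul
    ((continuous_gaussianKernel 1).inv₀ fun x => (gaussianKernel_pos one_pos x).ne')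
  simpa only [Pi.inv_apply, inv_smul_smul₀ (gaussianKernel_pos one_pos _).ne'] using hinv

end GaussianMeasure

section MehlerSemigroup

variable {V : Type*} [NormedAddCommGroup V] [InnerProductSpace ℝ V] [FiniteDimensional ℝ V]
  [MeasurableSpace V] [BorelSpace V]
variable {E : Type*} [NormedAddCommGroup E] [NormedSpace ℝ E] {f g : V → E} {t : ℝ}

/-- The Ornstein-Uhlenbeck semigroup on functions from a finite-dimensional inner product space
to a normed space; it is `ornsteinUhlenbeck` for scalar functions on `EuclideanSpace ℝ (Fin d)`. -/
def mehlerSemigroup (t : ℝ) (f : V → E) (x : V) : E :=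
  ∫ z, mehlerKernel t x z • f z

theorem integrable_mehlerKernel_smul (ht : 0 < t) (x : V) (hf : Integrable f (gaussianMeasure V)) :
    Integrable fun z => mehlerKernel t x z • f z := by
  have hs := one_sub_exp_neg_two_mul_pos ht
  set C := gaussianKernel (1 - exp (-2 * t)) (0 : V) / gaussianKernel 1 x
  have hC : ∀ z, mehlerKernel t x z ≤ C * gaussianKernel 1 z := fun z => by
    refine mehlerKernel_le_mul_gaussianKernel_one_of_swap ht ?_
    rw [div_mul_cancel₀ _ (gaussianKernel_pos one_pos x).ne']
    exact gaussianKernel_le_of_norm_le hs (by simp)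
  have hmeas : AEStronglyMeasurable (mehlerKernel t x) :=
    (integrable_of_integral_eq_one (integral_mehlerKernel ht x)).1
  refine ((integrable_gaussianMeasure_iff.1 hf).norm.const_mul C).mono'
    (hmeas.smul (aestronglyMeasurable_of_gaussianMeasure hf.1)) (ae_of_all _ fun z => ?_)
  rw [norm_smul, norm_smul, norm_of_nonneg (mehlerKernel_pos ht x z).le,
    norm_of_nonneg (gaussianKernel_pos one_pos z).le, ← mul_assoc]
  exact mul_le_mul_of_nonneg_right (hC z) (norm_nonneg _)

theorem mehlerSemigroup_sub (ht : 0 < t) (hf : Integrable f (gaussianMeasure V))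
    (hg : Integrable g (gaussianMeasure V)) :
    mehlerSemigroup t (f - g) = mehlerSemigroup t f - mehlerSemigroup t g := by
  ext x
  simp only [mehlerSemigroup, Pi.sub_apply, smul_sub]
  exact integral_sub (integrable_mehlerKernel_smul ht x hf) (integrable_mehlerKernel_smul ht x hg)

theorem enorm_mehlerSemigroup_le (ht : 0 < t) (f : V → E) (x : V) :
    ‖mehlerSemigroup t f x‖ₑ ≤ ∫⁻ z, ENNReal.ofReal (mehlerKernel t x z) * ‖f z‖ₑ :=
  enorm_integral_smul_le (fun z => (mehlerKernel_pos ht x z).le) f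

theorem enorm_mehlerSemigroup_le_of_bound (ht : 0 < t) {B : ℝ≥0∞} (hB : ∀ z, ‖f z‖ₑ ≤ B) (x : V) :
    ‖mehlerSemigroup t f x‖ₑ ≤ B := by
  calc ‖mehlerSemigroup t f x‖ₑ
      ≤ ∫⁻ z, ENNReal.ofReal (mehlerKernel t x z) * ‖f z‖ₑ := enorm_mehlerSemigroup_le ht f x
    _ ≤ ∫⁻ z, ENNReal.ofReal (mehlerKernel t x z) * B := by
        gcongr with z
        exact hB z
    _ = B := lintegral_mehlerKernel_mul_const ht x B

theorem aestronglyMeasurable_mehlerSemigroup (t : ℝ)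
    (hf : AEStronglyMeasurable f (gaussianMeasure V)) :
    AEStronglyMeasurable (mehlerSemigroup t f) (gaussianMeasure V) :=
  ((continuous_mehlerKernel t).aestronglyMeasurable.smul
    (aestronglyMeasurable_of_gaussianMeasure hf).comp_snd).integral_prod_right'.mono_ac
      gaussianMeasure_absolutelyContinuous

theorem lintegral_lintegral_mehlerKernel_mul (ht : 0 < t) {g : V → ℝ≥0∞} (hg : AEMeasurable g) :
    ∫⁻ x, (∫⁻ z, ENNReal.ofReal (mehlerKernel t x z) * g z) ∂(gaussianMeasure V) =
      ∫⁻ z, g z ∂(gaussianMeasure V) := by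
  have hγ := measurable_ofReal_gaussianKernel (V := V) 1
  have hK : Measurable fun p : V × V => ENNReal.ofReal (mehlerKernel t p.1 p.2) :=
    (continuous_mehlerKernel t).measurable.ennreal_ofReal
  have hrev : ∀ x z : V,
      ENNReal.ofReal (gaussianKernel 1 x) * (ENNReal.ofReal (mehlerKernel t x z) * g z) =
        ENNReal.ofReal (mehlerKernel t z x) * (ENNReal.ofReal (gaussianKernel 1 z) * g z) := by
    intro x z
    rw [← mul_assoc, ← mul_assoc, ← ENNReal.ofReal_mul (gaussianKernel_pos one_pos x).le,
      gaussianKernel_mul_mehlerKernel_comm ht, mul_comm (gaussianKernel 1 z),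
      ENNReal.ofReal_mul (mehlerKernel_pos ht z x).le]
  simp_rw [lintegral_gaussianMeasure, ← lintegral_const_mul' _ _ ENNReal.ofReal_ne_top]
  rw [lintegral_lintegral_swap
    (hγ.comp measurable_fst |>.aemeasurable.mul (hK.aemeasurable.mul hg.comp_snd))]
  refine lintegral_congr fun z => ?_
  simp_rw [hrev]
  exact lintegral_mehlerKernel_mul_const ht z _

theorem eLpNorm_one_mehlerSemigroup_le (ht : 0 < t)
    (hf : AEStronglyMeasurable f (gaussianMeasure V)) :
    eLpNorm (mehlerSemigroup t f) 1 (gaussianMeasure V) ≤ eLpNorm f 1 (gaussianMeasure V) := by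
  simp only [eLpNorm_one_eq_lintegral_enorm]
  calc ∫⁻ x, ‖mehlerSemigroup t f x‖ₑ ∂(gaussianMeasure V)
      ≤ ∫⁻ x, (∫⁻ z, ENNReal.ofReal (mehlerKernel t x z) * ‖f z‖ₑ) ∂(gaussianMeasure V) :=
        lintegral_mono fun x => enorm_mehlerSemigroup_le ht f x
    _ = ∫⁻ z, ‖f z‖ₑ ∂(gaussianMeasure V) :=
        lintegral_lintegral_mehlerKernel_mul ht (aestronglyMeasurable_of_gaussianMeasure hf).enorm

theorem integrable_mehlerSemigroup (ht : 0 < t) (hf : Integrable f (gaussianMeasure V)) :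
    Integrable (mehlerSemigroup t f) (gaussianMeasure V) := by
  rw [← memLp_one_iff_integrable] at hf ⊢
  exact ⟨aestronglyMeasurable_mehlerSemigroup t hf.1,
    (eLpNorm_one_mehlerSemigroup_le ht hf.1).trans_lt hf.2⟩

theorem eLpNorm_mehlerSemigroup_sub_le (ht : 0 < t)
    (hf : Integrable f (gaussianMeasure V)) (hg : Integrable g (gaussianMeasure V)) :
    eLpNorm (mehlerSemigroup t f - f) 1 (gaussianMeasure V) ≤
      eLpNorm (f - g) 1 (gaussianMeasure V) +
        eLpNorm (mehlerSemigroup t g - g) 1 (gaussianMeasure V) +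
          eLpNorm (f - g) 1 (gaussianMeasure V) := by
  have hfg := hf.sub hg
  have hTfg := aestronglyMeasurable_mehlerSemigroup t hfg.1
  have hTg := (aestronglyMeasurable_mehlerSemigroup t hg.1).sub hg.1
  calc eLpNorm (mehlerSemigroup t f - f) 1 (gaussianMeasure V)
      = eLpNorm (mehlerSemigroup t (f - g) + (mehlerSemigroup t g - g) - (f - g)) 1
          (gaussianMeasure V) := by
        rw [mehlerSemigroup_sub ht hf hg]
        congr 1
        abel
    _ ≤ eLpNorm (mehlerSemigroup t (f - g)) 1 (gaussianMeasure V) +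
          eLpNorm (mehlerSemigroup t g - g) 1 (gaussianMeasure V) +
            eLpNorm (f - g) 1 (gaussianMeasure V) :=
        (eLpNorm_sub_le (hTfg.add hTg) hfg.1 le_rfl).trans
          (add_le_add_left (eLpNorm_add_le hTfg hTg le_rfl) _)
    _ ≤ _ := by
        gcongr
        exact eLpNorm_one_mehlerSemigroup_le ht hfg.1

end MehlerSemigroup

section Convergence

/-- The parabolic cone `{(y, t) : t > 0, |y - x| ≤ a t^{1/2}}` of aperture `a` with vertex
`(x, 0)`; for `a = 0` it is the vertical half-line above `x`. -/
def parabolicCone {V : Type*} [NormedAddCommGroup V] (a : ℝ) (x : V) : Set (V × ℝ) :=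
  {p | 0 < p.2 ∧ ‖p.1 - x‖ ≤ a * √p.2}

theorem nhdsWithin_parabolicCone_le {V : Type*} [NormedAddCommGroup V] (a : ℝ) (x : V) :
    𝓝[parabolicCone a x] (x, 0) ≤ 𝓝 x ×ˢ 𝓝[>] 0 := by
  rw [← nhdsWithin_univ x, ← nhdsWithin_prod_eq]
  exact nhdsWithin_mono _ fun p hp => ⟨mem_univ _, hp.1⟩

theorem tendsto_prodMk_nhdsWithin_parabolicCone {V : Type*} [NormedAddCommGroup V] (x : V) :
    Tendsto (fun t : ℝ => (x, t)) (𝓝[>] 0) (𝓝[parabolicCone 0 x] (x, 0)) :=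
  ((Continuous.prodMk_right x).continuousWithinAt (x := 0)).tendsto_nhdsWithin
    fun t ht => ⟨ht, by simp⟩

variable {V : Type*} [NormedAddCommGroup V] [InnerProductSpace ℝ V] [FiniteDimensional ℝ V]
  [MeasurableSpace V] [BorelSpace V]
variable {E : Type*} [NormedAddCommGroup E] [NormedSpace ℝ E] [CompleteSpace E] {f : V → E}

theorem IsLebesguePoint.tendsto_mehlerSemigroup {x : V} (hx : IsLebesguePoint f x)
    (hf : Integrable f (gaussianMeasure V)) (a : ℝ) :
    Tendsto (fun p : V × ℝ => mehlerSemigroup p.2 f p.1) (𝓝[parabolicCone a x] (x, 0))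
      (𝓝 (f x)) := by
  have hcone : ∀ᶠ p in 𝓝[parabolicCone a x] (x, 0), p ∈ parabolicCone a x := self_mem_nhdsWithin
  have htime : ∀ᶠ p in 𝓝[parabolicCone a x] (x, 0), p.2 ≤ 1 / 2 :=
    nhdsWithin_le_nhds (continuous_snd.continuousAt.eventually_le_const (by norm_num))
  have hweight : ∫⁻ z, ENNReal.ofReal (gaussianKernel 1 z) * ‖f z - f x‖ₑ ≠ ∞ := by
    rw [← lintegral_gaussianMeasure]
    exact (hf.sub (integrable_const (f x))).2.ne
  refine hx.tendsto_integral_smul (aestronglyMeasurable_of_gaussianMeasure hf.1)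
    (C := 2 ^ ((finrank ℝ V : ℝ) / 2) * exp ((‖x‖ + a) ^ 2)) (by positivity) hweight
    (s := fun p => 2 * (1 - exp (-2 * p.2))) ?_ ?_ ?_ ?_ ?_ fun δ hδ η hη => ?_
  · exact hcone.mono fun p hp => mul_pos two_pos (one_sub_exp_neg_two_mul_pos hp.1)
  · exact hcone.mono fun p hp z => (mehlerKernel_pos hp.1 _ z).le
  · exact hcone.mono fun p hp => integral_mehlerKernel hp.1 _
  · exact hcone.mono fun p hp => integrable_mehlerKernel_smul hp.1 _ hf
  · exact (hcone.and htime).mono fun p hp =>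
      mehlerKernel_le_mul_gaussianKernel_sub hp.1.1 hp.2 hp.1.2
  · exact nhdsWithin_parabolicCone_le a x
      (eventually_mehlerKernel_le_mul_gaussianKernel_one x hδ hη)

theorem ae_tendsto_mehlerSemigroup_parabolicCone (hf : Integrable f (gaussianMeasure V)) :
    ∀ᵐ x ∂(gaussianMeasure V), ∀ a, Tendsto (fun p : V × ℝ => mehlerSemigroup p.2 f p.1)
      (𝓝[parabolicCone a x] (x, 0)) (𝓝 (f x)) :=
  gaussianMeasure_absolutelyContinuous.ae_le <|
    (ae_isLebesguePoint (locallyIntegrable_of_integrable_gaussianMeasure hf)).mono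
      fun _ hx => hx.tendsto_mehlerSemigroup hf

theorem ae_tendsto_mehlerSemigroup (hf : Integrable f (gaussianMeasure V)) :
    ∀ᵐ x ∂(gaussianMeasure V),
      Tendsto (fun t : ℝ => mehlerSemigroup t f x) (𝓝[>] 0) (𝓝 (f x)) := by
  filter_upwards [ae_tendsto_mehlerSemigroup_parabolicCone hf] with x hx
  have hvertical := (hx 0).comp (tendsto_prodMk_nhdsWithin_parabolicCone x)
  simpa only [Function.comp_def] using hvertical

theorem tendsto_eLpNorm_mehlerSemigroup_sub_of_bound (hf : Integrable f (gaussianMeasure V))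
    {B : ℝ≥0∞} (hB : B ≠ ∞) (hfB : ∀ x, ‖f x‖ₑ ≤ B) :
    Tendsto (fun t : ℝ => eLpNorm (mehlerSemigroup t f - f) 1 (gaussianMeasure V))
      (𝓝[>] 0) (𝓝 0) := by
  simp only [eLpNorm_one_eq_lintegral_enorm, Pi.sub_apply]
  rw [← lintegral_zero (μ := gaussianMeasure V)]
  refine tendsto_lintegral_filter_of_dominated_convergence' (fun _ => B + B) ?_ ?_ ?_ ?_
  · exact Eventually.of_forall fun t =>
      ((aestronglyMeasurable_mehlerSemigroup t hf.1).sub hf.1).enorm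
  · filter_upwards [self_mem_nhdsWithin] with t ht
    exact ae_of_all _ fun x => enorm_sub_le.trans
      (add_le_add (enorm_mehlerSemigroup_le_of_bound ht hfB x) (hfB x))
  · simp [hB]
  · filter_upwards [ae_tendsto_mehlerSemigroup hf] with x hx
    simpa using (hx.sub_const (f x)).enorm

theorem tendsto_eLpNorm_mehlerSemigroup_sub (hf : Integrable f (gaussianMeasure V)) :
    Tendsto (fun t : ℝ => eLpNorm (mehlerSemigroup t f - f) 1 (gaussianMeasure V))
      (𝓝[>] 0) (𝓝 0) := by
  refine ENNReal.tendsto_nhds_zero.2 fun ε hε => ?_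
  have hε₃ : ε / 3 ≠ 0 := (ENNReal.div_pos hε.ne' (by norm_num)).ne'
  obtain ⟨g, hfg, hg⟩ := (memLp_one_iff_integrable.2 hf).exists_boundedContinuous_eLpNorm_sub_le
    ENNReal.one_ne_top hε₃
  rw [memLp_one_iff_integrable] at hg
  have hgconv := tendsto_eLpNorm_mehlerSemigroup_sub_of_bound hg enorm_ne_top
    fun x => enorm_le_iff_norm_le.2 (g.norm_coe_le_norm x)
  filter_upwards [self_mem_nhdsWithin, ENNReal.tendsto_nhds_zero.1 hgconv _ hε₃.bot_lt]
    with t ht hgt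
  calc eLpNorm (mehlerSemigroup t f - f) 1 (gaussianMeasure V)
      ≤ ε / 3 + ε / 3 + ε / 3 := (eLpNorm_mehlerSemigroup_sub_le ht hf hg).trans (by gcongr)
    _ = ε := ENNReal.add_thirds ε

end Convergence

section EuclideanSpace

variable {d : ℕ}

theorem gaussianMeas_eq_gaussianMeasure (d : ℕ) :
    gaussianMeas d = gaussianMeasure (EuclideanSpace ℝ (Fin d)) := by
  simp [gaussianMeas, gaussianMeasure, gaussianKernel, div_eq_inv_mul]

theorem ornsteinUhlenbeck_eq_mehlerSemigroup {𝕜 : Type*} [RCLike 𝕜] :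
    (ornsteinUhlenbeck : ℝ → (EuclideanSpace ℝ (Fin d) → 𝕜) → EuclideanSpace ℝ (Fin d) → 𝕜) =
      mehlerSemigroup := by
  ext t f x
  simp only [ornsteinUhlenbeck, mehlerSemigroup, mehlerKernel, gaussianKernel, mul_smul,
    finrank_euclideanSpace_fin, integral_smul]

theorem parabolicGaussianCone_subset_parabolicCone (x : EuclideanSpace ℝ (Fin d)) :
    parabolicGaussianCone x ⊆ parabolicCone 1 x :=
  fun _ hp => ⟨hp.1, by simpa using hp.2.1.le⟩

end EuclideanSpace

theorem mainTheorem2_general {V : Type*} [NormedAddCommGroup V] [InnerProductSpace ℝ V]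
    [FiniteDimensional ℝ V] [MeasurableSpace V] [BorelSpace V]
    {E : Type*} [NormedAddCommGroup E] [NormedSpace ℝ E] [CompleteSpace E] {f : V → E}
    (hf : Integrable f (gaussianMeasure V)) :
    ((∀ t : ℝ, 0 < t → Integrable (mehlerSemigroup t f) (gaussianMeasure V)) ∧
      Tendsto (fun t : ℝ => eLpNorm (mehlerSemigroup t f - f) 1 (gaussianMeasure V))
        (𝓝[>] 0) (𝓝 0)) ∧
    (∀ᵐ x ∂(gaussianMeasure V),
      Tendsto (fun t : ℝ => mehlerSemigroup t f x) (𝓝[>] 0) (𝓝 (f x))) ∧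
    (∀ᵐ x ∂(gaussianMeasure V), ∀ a : ℝ,
      Tendsto (fun p : V × ℝ => mehlerSemigroup p.2 f p.1)
        (𝓝[parabolicCone a x] (x, 0)) (𝓝 (f x))) :=
  ⟨⟨fun _ ht => integrable_mehlerSemigroup ht hf, tendsto_eLpNorm_mehlerSemigroup_sub hf⟩,
    ae_tendsto_mehlerSemigroup hf, ae_tendsto_mehlerSemigroup_parabolicCone hf⟩

end

theorem mainTheorem2 {𝕜 : Type*} [RCLike 𝕜] (d : ℕ) (f : EuclideanSpace ℝ (Fin d) → 𝕜)
    (hf : Integrable f (gaussianMeas d)) :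
    -- convergence in `L¹(γ_d)` as `t → 0⁺`
    ((∀ t : ℝ, 0 < t → Integrable (ornsteinUhlenbeck t f) (gaussianMeas d)) ∧
      Tendsto (fun t : ℝ => eLpNorm (ornsteinUhlenbeck t f - f) 1 (gaussianMeas d))
        (𝓝[>] 0) (𝓝 0)) ∧
    -- convergence almost everywhere as `t → 0⁺`
    (∀ᵐ x ∂(gaussianMeas d),
      Tendsto (fun t : ℝ => ornsteinUhlenbeck t f x) (𝓝[>] 0) (𝓝 (f x))) ∧
    -- non-tangential convergence almost everywhere
    (∀ᵐ x ∂(gaussianMeas d),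
      Tendsto (fun p : EuclideanSpace ℝ (Fin d) × ℝ => ornsteinUhlenbeck p.2 f p.1)
        (𝓝[parabolicGaussianCone x] (x, 0)) (𝓝 (f x))) := by
  rw [gaussianMeas_eq_gaussianMeasure] at hf ⊢
  rw [ornsteinUhlenbeck_eq_mehlerSemigroup]
  obtain ⟨hL1, hvertical, hcone⟩ := mainTheorem2_general hf
  exact ⟨hL1, hvertical, hcone.mono fun x hx => (hx 1).mono_left
    (nhdsWithin_mono _ (parabolicGaussianCone_subset_parabolicCone x))⟩
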